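/- **Setting.** Let $\mathcal N$ be a finite set of agents and $\mathcal E$ a nonempty set of nonempty subsets of $\mathcal N$ (edges). A network is a point of $X=[0,1]^{\mathcal E}$. A (constrained) network game $\Gamma=(\mathcal N,\mathcal E,u,\alpha,\beta)$ consists of payoffs $u=(u_i)_{i\in\mathcal N}:X\to\mathbb R^{\mathcal N}$, capacities $\alpha_C\in[0,1]$ ($C\in\mathcal E$) and real budgets $\beta_i>0$ ($i\in\mathcal N$), none of which need be integral. Its feasible networks are $$X^{\alpha,\beta}=\Big\{x\in\prod_{C\in\mathcal E}[0,\alpha_C]:\ \sum_{C\ni i}x_C\le\beta_i\ \text{ for all } i\in\mathcal N\Big\}.$$ For $i\in\mathcal N$ write $x^i=(x_C)_{C\ni i}$ and $x^{-i}=(x_C)_{C\not\ni i}$. The game is * *continuous* if every $u_i$ is continuous on $X$; * *bipartite* with sides $U,V$ if $\mathcal N=U\sqcup V$ and every edge is $\{i,j\}$ with $i\in U$, $j\in V$; * *without externalities* if $u_i(x)=u_i(x^i,y^{-i})$ for all $i$, all $x\in X^{\alpha,\beta}$ and all $y\in X$; * *separable* if $u(x)=\sum_{C\in\mathcal E}u_C(x_C)$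 for all $x\in\prod_C[0,\alpha_C]$, with functions $u_C:[0,\alpha_C]\to\mathbb R^{\mathcal N}$; * *concave* if every $u_i$ is concave in each single coordinate $x_C\in[0,1]$, the other coordinates being fixed. A network $x$ is *fully stable* if 1. $x\in X^{\alpha,\beta}$; 2. for every agent $i$ and every $y\in X$ with $y^{-i}=x^{-i}$ and $y^i\le x^i$ (coordinatewise), $u_i(y)\le u_i(x)$; 3. for every $C\in\mathcal E$ and every $y\in X$ such that $y_{C'}=x_{C'}$ if $C'\cap C=\emptyset$, $x_C\le y_C\le\alpha_C$, $y_{C'}\le x_{C'}$ if $C'\ne C$ and $C'\cap C\ne\emptyset$, and $u_i(y)>u_i(x)$ for all $i\in C$, there is $j\in C$ with $\sum_{C'\ni j}y_{C'}>\beta_j$. **Generalized Deferred Acceptance (GDA)**, for a bipartite game without externalities. Write $u_i(y^i)$ for $u_i(y^i,0^{-i})$. Start with $x=0$ and the capacities $\alpha$ of $\Gamma$, and repeat the following round. * Every $i\in U$ chooses a maximizer $x'^i$ of $u_i(y^i)$ over all $y^i\in\prod_{C\ni i}[x_C,\alpha_C]$ with $\sum_{C\ni i}y_C\le\beta_i$.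 This defines the proposals $x'$. * If $x'=x$, terminate and return $x$. * Every $j\in V$ chooses a maximizer of $u_j(y^j)$ over all $y^j\in\prod_{C\ni j}[0,x'_C]$ with $\sum_{C\ni j}y_C\le\beta_j$. These choices form the new network $x$. * For every $C$ with $x_C<x'_C$ set $\alpha_C\leftarrow x_C$. If there are several maximizers, an arbitrary one may be chosen at each occasion. Say that a run *converges* to $z$ if it terminates and returns $z$, or if it has infinitely many rounds and its networks $x$ converge to $z$. **Theorem.** Let $\Gamma=(\mathcal N,\mathcal E,u,\alpha,\beta)$ be a continuous network game without externalities that is bipartite with sides $U,V$. 1. All maximizers that GDA asks for exist, however ties have been broken before; and every run of GDA converges, possibly in infinitely many rounds, to a network $x\in X^{\alpha,\beta}$. 2. If, in addition, $\Gamma$ is separable and concave, then the network to which a run of GDA converges is always fully stable. Both parts hold also for runs that are allowed to go on after rounds with $x'=x$. -/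

import Mathlib

open Filter Topology

/-- A constrained network game `(N, E, u, α, β)` on the finite set of agents `N`. Networks are
weight vectors `x : edges → ℝ` lying in `[0,1]^edges`; `payoff i x` is meaningful for such `x`
only, and no definition below looks at it elsewhere. -/
structure NetworkGame (N : Type*) [Fintype N] [DecidableEq N] where
  edges : Finset (Finset N)
  edges_nonempty : edges.Nonempty
  nonempty_of_mem : ∀ C ∈ edges, C.Nonempty
  payoff : N → (edges → ℝ) → ℝ
  /-- the capacity vector `α` -/
  cap : edges → ℝ
  cap_nonneg : ∀ C, 0 ≤ cap C
  cap_le_one : ∀ C, cap C ≤ 1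
  /-- the budget vector `β` -/
  budget : N → ℝ
  budget_pos : ∀ i, 0 < budget i

namespace NetworkGame

variable {N : Type*} [Fintype N] [DecidableEq N] (G : NetworkGame N)

/-- Weight vectors on the edges. -/
abbrev Weights : Type _ := G.edges → ℝ

/-- The set of networks `X = [0,1]^E`. -/
def networks : Set G.Weights := {x | ∀ C, 0 ≤ x C ∧ x C ≤ 1}

/-- The total weight that agent `i` spends in `x`: the sum of `x C` over the edges `C ∋ i`. -/
def load (i : N) (x : G.Weights) : ℝ := ∑ C : G.edges, if i ∈ C.1 then x C else 0

/-- The set `X^{α,β}` of feasible networks. -/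
def feasible : Set G.Weights :=
  {x | (∀ C, 0 ≤ x C ∧ x C ≤ G.cap C) ∧ ∀ i, G.load i x ≤ G.budget i}

/-- Every payoff function is continuous on the set of networks. -/
def IsContinuous : Prop := ∀ i, ContinuousOn (G.payoff i) G.networks

/-- `u = ∑_C u_C` with `u_C : [0, α_C] → ℝ^N`. -/
def IsSeparable : Prop :=
  ∃ w : G.edges → ℝ → N → ℝ, ∀ x : G.Weights, (∀ C, 0 ≤ x C ∧ x C ≤ G.cap C) →
    ∀ i, G.payoff i x = ∑ C : G.edges, w C (x C) i

/-- Every payoff function is concave in each single weight. -/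
def IsConcave : Prop :=
  ∀ i, ∀ C : G.edges, ∀ x ∈ G.networks,
    ConcaveOn ℝ (Set.Icc (0 : ℝ) 1) (fun t => G.payoff i (Function.update x C t))

/-- No externalities: at a feasible network, the payoff of `i` does not change when the weights of
edges that do not contain `i` are replaced by any others. -/
def NoExternalities : Prop :=
  ∀ i, ∀ x ∈ G.feasible, ∀ y ∈ G.networks,
    (∀ C : G.edges, i ∈ C.1 → y C = x C) → G.payoff i x = G.payoff i y

/-- `(N, E)` is a bipartite graph with sides `U` and `V`. -/
def IsBipartition (U V : Finset N) : Prop :=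
  Disjoint U V ∧ U ∪ V = Finset.univ ∧ ∀ C ∈ G.edges, ∃ i ∈ U, ∃ j ∈ V, C = {i, j}

/-- Fully stable networks. In the last two clauses `y` is the network after the deviation. -/
def IsFullyStable (x : G.Weights) : Prop :=
  x ∈ G.feasible ∧
  (∀ i, ∀ y ∈ G.networks,
    (∀ C : G.edges, i ∉ C.1 → y C = x C) →
    (∀ C : G.edges, i ∈ C.1 → y C ≤ x C) →
    G.payoff i y ≤ G.payoff i x) ∧
  (∀ C : G.edges, ∀ y ∈ G.networks,
    (∀ C' : G.edges, Disjoint C.1 C'.1 → y C' = x C') →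
    x C ≤ y C → y C ≤ G.cap C →
    (∀ C' : G.edges, C' ≠ C → ¬ Disjoint C.1 C'.1 → y C' ≤ x C') →
    (∀ i ∈ C.1, G.payoff i x < G.payoff i y) →
    ∃ j ∈ C.1, G.budget j < G.load j y)

/-! ### Generalized Deferred Acceptance -/

/-- `u_i(y^i)`: the payoff of `i` when the weights of the edges containing `i` are as in `y` and all
other weights are `0`. -/
noncomputable def ownPayoff (i : N) (y : G.Weights) : ℝ :=
  G.payoff i (fun C => if i ∈ C.1 then y C else 0)

/-- The choices `y^i ∈ ∏_{C ∋ i} [lo_C, hi_C]` of agent `i` that respect the budget of `i`. Only the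
coordinates `y C` with `i ∈ C` are restricted. -/
def choices (i : N) (lo hi : G.Weights) : Set G.Weights :=
  {y | (∀ C : G.edges, i ∈ C.1 → lo C ≤ y C ∧ y C ≤ hi C) ∧ G.load i y ≤ G.budget i}

/-- The choices of agent `i` of maximal payoff. -/
def bestChoices (i : N) (lo hi : G.Weights) : Set G.Weights :=
  {y | y ∈ G.choices i lo hi ∧ IsMaxOn (G.ownPayoff i) (G.choices i lo hi) y}

/-- The variables of the algorithm: the current network and the current capacities. -/
@[ext]
structure GDAState where
  weights : G.Weights
  cap : G.Weights

/-- Initially the network is `0` and the capacities are those of the game. -/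
def gdaInit : G.GDAState := ⟨fun _ => 0, G.cap⟩

/-- Proposals: `p^i` is a best choice of every `i ∈ U` between the current weights and the
current capacities. Ties may be broken in any way. -/
def IsProposal (U : Finset N) (s : G.GDAState) (p : G.Weights) : Prop :=
  ∀ i ∈ U, p ∈ G.bestChoices i s.weights s.cap

/-- One full round from `s` to `t` with proposals `p`: the agents in `U` propose `p`, every `j ∈ V`
makes a best choice between `0` and `p` (ties may be broken in any way), and an edge whose
proposed weight has been reduced gets the new weight as its capacity. -/
def IsRound (U V : Finset N) (s : G.GDAState) (p : G.Weights) (t : G.GDAState) : Prop :=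
  G.IsProposal U s p ∧
  (∀ j ∈ V, t.weights ∈ G.bestChoices j (fun _ => 0) p) ∧
  (∀ C, (t.weights C < p C → t.cap C = t.weights C) ∧ (¬ t.weights C < p C → t.cap C = s.cap C))

/-- The states that the algorithm can reach. -/
def GDAReachable (U V : Finset N) (s : G.GDAState) : Prop :=
  Relation.ReflTransGen (fun s t => ∃ p, G.IsRound U V s p t) G.gdaInit s

/-- A run of the algorithm with `len` full rounds, `len = ⊤` if it never terminates. It can
terminate only when the proposals equal the current network. (A run that goes on although its
proposals equal the current network is a run too, so that all termination tests which imply this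
equality are covered.) The values `state n` and `proposal n` for `n > len` have no meaning. -/
structure GDARun (U V : Finset N) where
  len : ℕ∞
  state : ℕ → G.GDAState
  proposal : ℕ → G.Weights
  state_zero : state 0 = G.gdaInit
  isProposal : ∀ n : ℕ, (n : ℕ∞) ≤ len → G.IsProposal U (state n) (proposal n)
  isRound : ∀ n : ℕ, (n : ℕ∞) < len → G.IsRound U V (state n) (proposal n) (state (n + 1))
  terminate : ∀ n : ℕ, len = n → proposal n = (state n).weights

variable {G}

/-- The run terminates as soon as the proposals equal the current network. -/
def GDARun.IsPrompt {U V : Finset N} (r : G.GDARun U V) : Prop :=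
  ∀ n : ℕ, (n : ℕ∞) < r.len → r.proposal n ≠ (r.state n).weights

/-- The run terminates and returns `z`, or it goes on forever and its networks converge to `z`. -/
def GDARun.ConvergesTo {U V : Finset N} (r : G.GDARun U V) (z : G.Weights) : Prop :=
  (∃ n : ℕ, r.len = n ∧ (r.state n).weights = z) ∨
  (r.len = ⊤ ∧ Tendsto (fun n => (r.state n).weights) atTop (𝓝 z))

end NetworkGame

namespace NetworkGame

variable {N : Type*} [Fintype N] [DecidableEq N] {G : NetworkGame N} {U V : Finset N}

/-! ### Choices -/

/-! Convergence: each edge has two phases. Until its weight is first cut back by the receiving side,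
every proposal on it is accepted in full, so its weight can only rise. From the first cut on, its
capacity equals its weight, so the proposer can only propose the current weight, and the weight can
only fall. Each coordinate is thus bounded and eventually monotone (`exists_tendsto`), and the
proposals have the same limit (`tendsto_proposal`). A terminating run is treated as an infinite one
that stays put.

Stability: separability and the absence of externalities turn payoffs into sums of concave
one-variable gains, and optimality into inequalities between secant slopes. Two facts survive all
rounds. Nobody gains by lowering a weight (`NoGainDown`). On each edge one endpoint has no use for
more weight (`IsSaturated`): the proposer before the first cut (`isSaturated_proposal`), the
receiver after it (`isSaturated_weights`). Concavity carries these facts from round to round, and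
continuity carries them to the limit, since slopes of nondegenerate secants, unlike derivatives,
depend continuously on the endpoints. At the limit, the saturated endpoint of an edge cannot gain by
a deviation within its budget that raises this edge alone (`IsSaturated.gain_le`), so no edge
blocks. -/

lemma load_mono {i : N} {x y : G.Weights} (h : ∀ C : G.edges, i ∈ C.1 → x C ≤ y C) :
    G.load i x ≤ G.load i y := by
  refine Finset.sum_le_sum fun C _ => ?_
  split_ifs with hC
  exacts [h C hC, le_rfl]

lemma load_congr {i : N} {x y : G.Weights} (h : ∀ C : G.edges, i ∈ C.1 → x C = y C) :
    G.load i x = G.load i y :=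
  le_antisymm (load_mono fun C hC => (h C hC).le) (load_mono fun C hC => (h C hC).ge)

lemma load_zero (i : N) : G.load i (fun _ => 0) = 0 := by simp [load]

lemma continuous_load (i : N) : Continuous (G.load i) := by
  refine continuous_finsetSum _ fun C _ => ?_
  split_ifs
  exacts [continuous_apply C, continuous_const]

lemma ownPayoff_congr {i : N} {x y : G.Weights} (h : ∀ C : G.edges, i ∈ C.1 → x C = y C) :
    G.ownPayoff i x = G.ownPayoff i y := by
  unfold ownPayoff
  congr 1
  funext C
  split_ifs with hC
  exacts [h C hC, rfl]

lemma choices_congr {i : N} {lo hi x y : G.Weights} (h : ∀ C : G.edges, i ∈ C.1 → x C = y C)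
    (hx : x ∈ G.choices i lo hi) : y ∈ G.choices i lo hi :=
  ⟨fun C hC => h C hC ▸ hx.1 C hC, load_congr h ▸ hx.2⟩

lemma bestChoices_congr {i : N} {lo hi x y : G.Weights}
    (h : ∀ C : G.edges, i ∈ C.1 → x C = y C) (hx : x ∈ G.bestChoices i lo hi) :
    y ∈ G.bestChoices i lo hi :=
  ⟨choices_congr h hx.1, fun z hz => by
    simpa only [Set.mem_ofPred_eq, ownPayoff_congr h] using hx.2 hz⟩

/-- `choices` leaves the edges away from `i` free and so need not be compact. Setting those weights
to `0` does not affect `ownPayoff` and leads to the compact set `K`. -/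
lemma bestChoices_nonempty (hcont : G.IsContinuous) {i : N} {lo hi : G.Weights}
    (hlo : ∀ C, 0 ≤ lo C) (hhi : ∀ C, hi C ≤ 1) (hne : (G.choices i lo hi).Nonempty) :
    (G.bestChoices i lo hi).Nonempty := by
  set mask : G.Weights → G.Weights := fun y C => if i ∈ C.1 then y C else 0 with hmask
  have hmask_eq (y : G.Weights) (C : G.edges) (hC : i ∈ C.1) : y C = mask y C := by
    simp [hmask, hC]
  set K : Set G.Weights := G.choices i lo hi ∩ {y | ∀ C : G.edges, i ∉ C.1 → y C = 0} with hK
  have mask_mem {y : G.Weights} (hy : y ∈ G.choices i lo hi) : mask y ∈ K :=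
    ⟨choices_congr (hmask_eq y) hy, fun C hC => by simp [hmask, hC]⟩
  have hKX : K ⊆ Set.Icc 0 1 := by
    rintro y ⟨hy, hy0⟩
    refine ⟨fun C => ?_, fun C => ?_⟩ <;> by_cases hC : i ∈ C.1
    · exact (hlo C).trans (hy.1 C hC).1
    · exact (hy0 C hC).ge
    · exact (hy.1 C hC).2.trans (hhi C)
    · simp [hy0 C hC]
  have hclosed : IsClosed K := by
    have : K = (⋂ C : G.edges, {y | i ∈ C.1 → lo C ≤ y C ∧ y C ≤ hi C}) ∩
        {y | G.load i y ≤ G.budget i} ∩ ⋂ C : G.edges, {y | i ∉ C.1 → y C = 0} := by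
      ext y
      simp [hK, choices]
    rw [this]
    refine (IsClosed.inter (isClosed_iInter fun C => ?_) ?_).inter (isClosed_iInter fun C => ?_)
    · by_cases hC : i ∈ C.1 <;> simp only [hC, true_imp_iff, false_imp_iff, Set.ofPred_true]
      · exact (isClosed_le continuous_const (continuous_apply C)).inter
          (isClosed_le (continuous_apply C) continuous_const)
      · exact isClosed_univ
    · exact isClosed_le (continuous_load i) continuous_const
    · by_cases hC : i ∈ C.1 <;>
        simp only [hC, not_true, not_false_eq_true, true_imp_iff, false_imp_iff, Set.ofPred_true]
      · exact isClosed_univ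
      · exact isClosed_eq (continuous_apply C) continuous_const
  have hcpt : IsCompact K := isCompact_Icc.of_isClosed_subset hclosed hKX
  obtain ⟨y₀, hy₀⟩ := hne
  obtain ⟨y, hyK, hy⟩ := hcpt.exists_isMaxOn ⟨_, mask_mem hy₀⟩
    ((hcont i).mono fun y hy C => ⟨(hKX hy).1 C, (hKX hy).2 C⟩)
  refine ⟨y, hyK.1, fun z hz => ?_⟩
  have hyy : G.ownPayoff i y = G.payoff i y := by
    unfold ownPayoff
    congr 1
    funext C
    split_ifs with hC
    exacts [rfl, (hyK.2 C hC).symm]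
  rw [Set.mem_ofPred_eq, hyy]
  exact hy (mask_mem hz)

/-- Best choices of agents no two of which share an edge fit together. -/
lemma exists_forall_mem_bestChoices {W : Finset N} {lo hi : G.Weights}
    (hW : ∀ C : G.edges, ∃ k, ∀ i ∈ W, i ∈ C.1 → i = k)
    (h : ∀ i ∈ W, (G.bestChoices i lo hi).Nonempty) :
    ∃ p, ∀ i ∈ W, p ∈ G.bestChoices i lo hi := by
  choose k hk using hW
  have h' : ∀ i, ∃ y, i ∈ W → y ∈ G.bestChoices i lo hi := fun i => by
    by_cases hi : i ∈ W
    · exact (h i hi).imp fun y hy _ => hy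
    · exact ⟨0, fun h => absurd h hi⟩
  choose y hy using h'
  -- On each edge, take the choice of the only agent of `W` who can be on it.
  refine ⟨fun C => y (k C) C, fun i hi => bestChoices_congr (fun C hC => ?_) (hy i hi)⟩
  rw [hk C i hi hC]

lemma IsBipartition.exists_left (hbip : G.IsBipartition U V) (C : G.edges) :
    ∃ i ∈ U, i ∈ C.1 ∧ ∀ k ∈ U, k ∈ C.1 → k = i := by
  obtain ⟨i, hi, j, hj, h⟩ := hbip.2.2 C.1 C.2
  refine ⟨i, hi, by simp [h], fun k hk hkC => ?_⟩
  rw [h, Finset.mem_insert, Finset.mem_singleton] at hkC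
  rcases hkC with rfl | rfl
  · rfl
  · exact (Finset.disjoint_left.mp hbip.1 hk hj).elim

lemma IsBipartition.symm (hbip : G.IsBipartition U V) : G.IsBipartition V U := by
  refine ⟨hbip.1.symm, Finset.union_comm V U ▸ hbip.2.1, fun C hC => ?_⟩
  obtain ⟨i, hi, j, hj, h⟩ := hbip.2.2 C hC
  exact ⟨j, hj, i, hi, h.trans (Finset.pair_comm i j)⟩

lemma IsBipartition.mem_or_mem (hbip : G.IsBipartition U V) (i : N) : i ∈ U ∨ i ∈ V := by
  rw [← Finset.mem_union, hbip.2.1]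
  exact Finset.mem_univ i

lemma isClosed_feasible : IsClosed G.feasible := by
  have : G.feasible = (⋂ C : G.edges, {y | 0 ≤ y C ∧ y C ≤ G.cap C}) ∩
      ⋂ i, {y | G.load i y ≤ G.budget i} := by
    ext y
    simp [feasible]
  rw [this]
  refine (isClosed_iInter fun C => ?_).inter (isClosed_iInter fun i => ?_)
  · exact (isClosed_le continuous_const (continuous_apply C)).inter
      (isClosed_le (continuous_apply C) continuous_const)
  · exact isClosed_le (continuous_load i) continuous_const

/-! ### Invariants of the states -/

/-- The properties of a state that every round preserves. -/
structure IsValid (V : Finset N) (s : G.GDAState) : Prop where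
  feasible : s.weights ∈ G.feasible
  weights_le : ∀ C, s.weights C ≤ s.cap C
  cap_le : ∀ C, s.cap C ≤ G.cap C
  best : ∀ j ∈ V, s.weights ∈ G.bestChoices j (fun _ => 0) s.weights

lemma isValid_gdaInit : IsValid V G.gdaInit where
  feasible := ⟨fun C => ⟨le_rfl, G.cap_nonneg C⟩, fun i =>
    (load_zero (G := G) i).le.trans (G.budget_pos i).le⟩
  weights_le := G.cap_nonneg
  cap_le _ := le_rfl
  best j _ := by
    refine ⟨⟨fun C _ => ⟨le_rfl, le_rfl⟩, (load_zero (G := G) j).le.trans (G.budget_pos j).le⟩,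
      fun y hy => (ownPayoff_congr fun C hC => ?_).le⟩
    exact le_antisymm (hy.1 C hC).2 (hy.1 C hC).1

lemma IsProposal.weights_le (hbip : G.IsBipartition U V) {s : G.GDAState} {p : G.Weights}
    (hp : G.IsProposal U s p) (C : G.edges) : s.weights C ≤ p C := by
  obtain ⟨i, hi, hiC, -⟩ := hbip.exists_left C
  exact ((hp i hi).1.1 C hiC).1

lemma IsProposal.le_cap (hbip : G.IsBipartition U V) {s : G.GDAState} {p : G.Weights}
    (hp : G.IsProposal U s p) (C : G.edges) : p C ≤ s.cap C := by
  obtain ⟨i, hi, hiC, -⟩ := hbip.exists_left C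
  exact ((hp i hi).1.1 C hiC).2

lemma IsRound.weights_nonneg (hbip : G.IsBipartition U V) {s t : G.GDAState} {p : G.Weights}
    (h : G.IsRound U V s p t) (C : G.edges) : 0 ≤ t.weights C := by
  obtain ⟨j, hj, hjC, -⟩ := hbip.symm.exists_left C
  exact ((h.2.1 j hj).1.1 C hjC).1

lemma IsRound.weights_le (hbip : G.IsBipartition U V) {s t : G.GDAState} {p : G.Weights}
    (h : G.IsRound U V s p t) (C : G.edges) : t.weights C ≤ p C := by
  obtain ⟨j, hj, hjC, -⟩ := hbip.symm.exists_left C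
  exact ((h.2.1 j hj).1.1 C hjC).2

/-- Receivers only cut proposals, so the proposers' budgets remain respected. A best choice from
`[0, p]` stays best when the upper bound shrinks to that choice. -/
lemma IsRound.isValid (hbip : G.IsBipartition U V) {s t : G.GDAState} {p : G.Weights}
    (h : G.IsRound U V s p t) (hs : IsValid V s) : IsValid V t := by
  have htp := h.weights_le hbip
  have hpa := h.1.le_cap hbip
  have hta (C : G.edges) : t.weights C ≤ t.cap C ∧ t.cap C ≤ s.cap C := by
    by_cases hC : t.weights C < p C
    · rw [(h.2.2 C).1 hC]
      exact ⟨le_rfl, (htp C).trans (hpa C)⟩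
    · rw [(h.2.2 C).2 hC]
      exact ⟨(htp C).trans (hpa C), le_rfl⟩
  refine ⟨⟨fun C => ⟨h.weights_nonneg hbip C, (htp C).trans ((hpa C).trans (hs.cap_le C))⟩,
    fun i => ?_⟩, fun C => (hta C).1, fun C => (hta C).2.trans (hs.cap_le C), fun j hj => ?_⟩
  · rcases hbip.mem_or_mem i with hi | hi
    · exact (load_mono fun C _ => htp C).trans (h.1 i hi).1.2
    · exact (h.2.1 i hi).1.2
  · have hb := h.2.1 j hj
    exact ⟨⟨fun C hC => ⟨(hb.1.1 C hC).1, le_rfl⟩, hb.1.2⟩, fun y hy =>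
      hb.2 ⟨fun C hC => ⟨(hy.1 C hC).1, (hy.1 C hC).2.trans (htp C)⟩, hy.2⟩⟩

lemma GDAReachable.isValid (hbip : G.IsBipartition U V) {s : G.GDAState}
    (h : G.GDAReachable U V s) : IsValid V s := by
  induction h with
  | refl => exact isValid_gdaInit
  | tail _ h ih => exact h.choose_spec.isValid hbip ih

/-- The current network is itself an admissible proposal, so no proposer faces an empty choice set.
-/
lemma IsValid.exists_isProposal (hbip : G.IsBipartition U V) (hcont : G.IsContinuous)
    {s : G.GDAState} (hs : IsValid V s) : ∃ p, G.IsProposal U s p := by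
  refine exists_forall_mem_bestChoices (fun C => ?_) fun i _ => ?_
  · obtain ⟨i, -, -, h⟩ := hbip.exists_left C
    exact ⟨i, h⟩
  · exact bestChoices_nonempty hcont (fun C => (hs.feasible.1 C).1)
      (fun C => (hs.cap_le C).trans (G.cap_le_one C))
      ⟨s.weights, fun C _ => ⟨le_rfl, hs.weights_le C⟩, hs.feasible.2 i⟩

lemma IsValid.exists_isRound (hbip : G.IsBipartition U V) (hcont : G.IsContinuous)
    {s : G.GDAState} (hs : IsValid V s) {p : G.Weights} (hp : G.IsProposal U s p) :
    ∃ t, G.IsRound U V s p t := by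
  have hp1 (C : G.edges) : p C ≤ 1 :=
    (hp.le_cap hbip C).trans ((hs.cap_le C).trans (G.cap_le_one C))
  have hp0 (C : G.edges) : 0 ≤ p C := (hs.feasible.1 C).1.trans (hp.weights_le hbip C)
  obtain ⟨x, hx⟩ : ∃ x, ∀ j ∈ V, x ∈ G.bestChoices j (fun _ => 0) p := by
    refine exists_forall_mem_bestChoices (fun C => ?_) fun j _ => ?_
    · obtain ⟨j, -, -, h⟩ := hbip.symm.exists_left C
      exact ⟨j, h⟩
    · exact bestChoices_nonempty hcont (fun C => le_rfl) hp1
        ⟨fun _ => 0, fun C _ => ⟨le_rfl, hp0 C⟩,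
          (load_zero (G := G) j).le.trans (G.budget_pos j).le⟩
  refine ⟨⟨x, fun C => if x C < p C then x C else s.cap C⟩, hp, hx, fun C => ?_⟩
  exact ⟨fun h => if_pos h, fun h => if_neg h⟩

/-- A state at which the proposals equal the current network may be repeated. -/
lemma IsValid.isRound_self {s : G.GDAState} (hs : IsValid V s)
    (hp : G.IsProposal U s s.weights) : G.IsRound U V s s.weights s :=
  ⟨hp, hs.best, fun _ => ⟨fun h => absurd h (lt_irrefl _), fun _ => rfl⟩⟩

/-! ### Infinite runs -/

/-- A run with infinitely many rounds. -/
structure IsInfiniteRun (U V : Finset N) (s : ℕ → G.GDAState) (p : ℕ → G.Weights) : Prop where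
  zero : s 0 = G.gdaInit
  isRound : ∀ n, G.IsRound U V (s n) (p n) (s (n + 1))

lemma GDARun.isValid (hbip : G.IsBipartition U V) (r : G.GDARun U V) :
    ∀ n : ℕ, (n : ℕ∞) ≤ r.len → IsValid V (r.state n)
  | 0, _ => r.state_zero ▸ isValid_gdaInit
  | n + 1, h => by
    have hn : (n : ℕ∞) < r.len := lt_of_lt_of_le (by exact_mod_cast n.lt_succ_self) h
    exact (r.isRound n hn).isValid hbip (r.isValid hbip n hn.le)

/-- A terminated run can repeat its last state forever, by `IsValid.isRound_self`; its limit is then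
the network returned. -/
lemma GDARun.exists_isInfiniteRun (hbip : G.IsBipartition U V) (r : G.GDARun U V) :
    ∃ s p, IsInfiniteRun U V s p ∧
      ∀ z, r.ConvergesTo z ↔ Tendsto (fun n => (s n).weights) atTop (𝓝 z) := by
  rcases eq_or_ne r.len ⊤ with hr | hr
  · refine ⟨r.state, r.proposal, ⟨r.state_zero, fun n => r.isRound n ?_⟩, fun z => ?_⟩
    · rw [hr]
      exact ENat.natCast_lt_top n
    · simp [ConvergesTo, hr]
  · obtain ⟨m, hm⟩ := ENat.ne_top_iff_exists.mp hr
    have hpm : r.proposal m = (r.state m).weights := r.terminate m hm.symm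
    have hself : G.IsRound U V (r.state m) (r.proposal m) (r.state m) := by
      have h := r.isProposal m hm.le
      rw [hpm] at h ⊢
      exact (r.isValid hbip m hm.le).isRound_self h
    refine ⟨fun n => r.state (min n m), fun n => r.proposal (min n m),
      ⟨by simpa using r.state_zero, fun n => ?_⟩, fun z => ?_⟩
    · rcases lt_or_ge n m with hn | hn
      · simpa [hn.le, Nat.succ_le_of_lt hn] using
          r.isRound n (by rw [← hm]; exact_mod_cast hn)
      · simpa [hn, hn.trans n.le_succ] using hself
    · have ht : Tendsto (fun n => (r.state (min n m)).weights) atTop (𝓝 (r.state m).weights) := by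
        refine tendsto_const_nhds.congr' ?_
        filter_upwards [eventually_ge_atTop m] with n hn
        rw [min_eq_right hn]
      have hcv : r.ConvergesTo z ↔ (r.state m).weights = z := by
        simp [ConvergesTo, ← hm]
      rw [hcv]
      exact ⟨fun h => h ▸ ht, fun h => tendsto_nhds_unique ht h⟩

/-- Fix one way of breaking ties, iterate it forever, and let the length be the first round whose
proposals repeat the network, if there is one. -/
lemma exists_isPrompt (hbip : G.IsBipartition U V) (hcont : G.IsContinuous) :
    ∃ r : G.GDARun U V, r.IsPrompt := by
  classical
  choose! p hp using fun (s : G.GDAState) (hs : IsValid V s) =>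
    hs.exists_isProposal (U := U) hbip hcont
  choose! t ht using fun (s : G.GDAState) (hs : IsValid V s) =>
    hs.exists_isRound hbip hcont (hp s hs)
  set s : ℕ → G.GDAState := fun n => t^[n] G.gdaInit with hs
  have hsucc (n : ℕ) : s (n + 1) = t (s n) := Function.iterate_succ_apply' _ _ _
  have hvalid : ∀ n, IsValid V (s n) := fun n => by
    induction n with
    | zero => exact isValid_gdaInit
    | succ n ih =>
      rw [hsucc]
      exact (ht _ ih).isValid hbip ih
  have hround (n : ℕ) : G.IsRound U V (s n) (p (s n)) (s (n + 1)) := by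
    rw [hsucc]
    exact ht _ (hvalid n)
  by_cases hex : ∃ n, p (s n) = (s n).weights
  · refine ⟨⟨(Nat.find hex : ℕ), s, fun n => p (s n), rfl, fun n _ => hp _ (hvalid n),
      fun n _ => hround n, fun n hn => ?_⟩, fun n hn => ?_⟩
    · obtain rfl : Nat.find hex = n := by exact_mod_cast hn
      exact Nat.find_spec hex
    · exact Nat.find_min hex (Nat.cast_lt.mp hn)
  · push Not at hex
    exact ⟨⟨⊤, s, fun n => p (s n), rfl, fun n _ => hp _ (hvalid n), fun n _ => hround n,
      fun n hn => (ENat.top_ne_natCast n hn).elim⟩, fun n _ => hex n⟩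

/-! ### The two phases of an edge, and convergence -/

namespace IsInfiniteRun

variable {s : ℕ → G.GDAState} {p : ℕ → G.Weights}

lemma isValid (hbip : G.IsBipartition U V) (h : IsInfiniteRun U V s p) :
    ∀ n, IsValid V (s n)
  | 0 => h.zero ▸ isValid_gdaInit
  | n + 1 => (h.isRound n).isValid hbip (h.isValid hbip n)

/-- The weight of `C` has been reduced in one of the first `n` rounds. -/
def Reduced (s : ℕ → G.GDAState) (p : ℕ → G.Weights) (C : G.edges) (n : ℕ) : Prop :=
  ∃ m < n, (s (m + 1)).weights C < p m C

lemma Reduced.mono {C : G.edges} {m n : ℕ} (h : Reduced s p C m) (hmn : m ≤ n) :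
    Reduced s p C n :=
  h.imp fun _ hk => ⟨hk.1.trans_le hmn, hk.2⟩

lemma proposal_eq_of_not_reduced (hbip : G.IsBipartition U V) (h : IsInfiniteRun U V s p)
    {C : G.edges} {n : ℕ} (hC : ¬ Reduced s p C (n + 1)) :
    p n C = (s (n + 1)).weights C :=
  le_antisymm (not_lt.mp fun hlt => hC ⟨n, n.lt_succ_self, hlt⟩)
    ((h.isRound n).weights_le hbip C)

lemma cap_eq_of_not_reduced (h : IsInfiniteRun U V s p) {C : G.edges} {n : ℕ}
    (hC : ¬ Reduced s p C n) : (s n).cap C = G.cap C := by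
  induction n with
  | zero => rw [h.zero]; rfl
  | succ n ih =>
    rw [((h.isRound n).2.2 C).2 fun hlt => hC ⟨n, n.lt_succ_self, hlt⟩]
    exact ih fun hr => hC (hr.mono n.le_succ)

/-- A cut sets the capacity to the weight. In a later round without a cut, the proposal is squeezed
between the old weight and the old capacity, which agree. -/
lemma weights_eq_cap_of_reduced (hbip : G.IsBipartition U V) (h : IsInfiniteRun U V s p)
    {C : G.edges} {n : ℕ} (hC : Reduced s p C n) : (s n).weights C = (s n).cap C := by
  induction n with
  | zero => obtain ⟨m, hm, -⟩ := hC; omega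
  | succ n ih =>
    by_cases hlt : (s (n + 1)).weights C < p n C
    · exact (((h.isRound n).2.2 C).1 hlt).symm
    · have hn : Reduced s p C n := by
        obtain ⟨m, hm, hr⟩ := hC
        refine ⟨m, lt_of_le_of_ne (Nat.lt_succ_iff.mp hm) ?_, hr⟩
        rintro rfl
        exact hlt hr
      have h1 := (h.isRound n).1.weights_le hbip C
      have h2 := (h.isRound n).1.le_cap hbip C
      have h3 := (h.isRound n).weights_le hbip C
      rw [((h.isRound n).2.2 C).2 hlt]
      have := ih hn
      linarith [not_lt.mp hlt]

lemma proposal_eq_of_reduced (hbip : G.IsBipartition U V) (h : IsInfiniteRun U V s p)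
    {C : G.edges} {n : ℕ} (hC : Reduced s p C n) : p n C = (s n).weights C :=
  le_antisymm (((h.isRound n).1.le_cap hbip C).trans
    (h.weights_eq_cap_of_reduced hbip hC).ge) ((h.isRound n).1.weights_le hbip C)

lemma exists_tendsto (hbip : G.IsBipartition U V) (h : IsInfiniteRun U V s p) :
    ∃ z, Tendsto (fun n => (s n).weights) atTop (𝓝 z) := by
  suffices hC : ∀ C, ∃ v, Tendsto (fun n => (s n).weights C) atTop (𝓝 v) by
    choose z hz using hC
    exact ⟨z, tendsto_pi_nhds.mpr hz⟩
  intro C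
  by_cases hr : ∃ m, Reduced s p C m
  · obtain ⟨m, hm⟩ := hr
    have hanti : Antitone fun n => (s (n + m)).weights C := by
      refine antitone_nat_of_succ_le fun n => ?_
      rw [← h.proposal_eq_of_reduced hbip (hm.mono (Nat.le_add_left m n)),
        Nat.add_right_comm n 1 m]
      exact (h.isRound (n + m)).weights_le hbip C
    refine ⟨_, (tendsto_add_atTop_iff_nat m).mp (tendsto_atTop_ciInf hanti ⟨0, ?_⟩)⟩
    rintro _ ⟨n, rfl⟩
    exact ((h.isValid hbip (n + m)).feasible.1 C).1
  · push Not at hr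
    have hmono : Monotone fun n => (s n).weights C := by
      refine monotone_nat_of_le_succ fun n => ?_
      rw [← h.proposal_eq_of_not_reduced hbip (hr (n + 1))]
      exact (h.isRound n).1.weights_le hbip C
    refine ⟨_, tendsto_atTop_ciSup hmono ⟨1, ?_⟩⟩
    rintro _ ⟨n, rfl⟩
    exact ((h.isValid hbip n).feasible.1 C).2.trans (G.cap_le_one C)

/-- On each edge the proposal eventually equals the old weight (after a cut) or always equals the
next weight (if there is never a cut). -/
lemma tendsto_proposal (hbip : G.IsBipartition U V) (h : IsInfiniteRun U V s p)
    {z : G.Weights} (hz : Tendsto (fun n => (s n).weights) atTop (𝓝 z)) :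
    Tendsto p atTop (𝓝 z) := by
  refine tendsto_pi_nhds.mpr fun C => ?_
  have hzC := tendsto_pi_nhds.mp hz C
  by_cases hr : ∃ m, Reduced s p C m
  · obtain ⟨m, hm⟩ := hr
    refine hzC.congr' ?_
    filter_upwards [eventually_ge_atTop m] with n hn
    exact (h.proposal_eq_of_reduced hbip (hm.mono hn)).symm
  · push Not at hr
    refine ((tendsto_add_atTop_iff_nat 1).mpr hzC).congr fun n => ?_
    exact (h.proposal_eq_of_not_reduced hbip (hr (n + 1))).symm

lemma limit_mem_feasible (hbip : G.IsBipartition U V) (h : IsInfiniteRun U V s p)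
    {z : G.Weights} (hz : Tendsto (fun n => (s n).weights) atTop (𝓝 z)) : z ∈ G.feasible :=
  isClosed_feasible.mem_of_tendsto hz
    (Eventually.of_forall fun n => (h.isValid hbip n).feasible)

end IsInfiniteRun

end NetworkGame

/-- The slopes of a concave function decrease when both ends of the interval move up. -/
lemma ConcaveOn.slope_le_slope {S : Set ℝ} {f : ℝ → ℝ} (hf : ConcaveOn ℝ S f) {a b c d : ℝ}
    (ha : a ∈ S) (hb : b ∈ S) (hc : c ∈ S) (hd : d ∈ S) (hab : a < b) (hcd : c < d)
    (hac : a ≤ c) (hbd : b ≤ d) : slope f c d ≤ slope f a b :=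
  calc slope f c d = slope f d c := slope_comm f c d
    _ ≤ slope f d a :=
      hf.slope_anti hd ⟨ha, ((hab.trans_le hbd).ne : a ≠ d)⟩ ⟨hc, (hcd.ne : c ≠ d)⟩ hac
    _ = slope f a d := slope_comm f d a
    _ ≤ slope f a b :=
      hf.slope_anti ha ⟨hb, (hab.ne' : b ≠ a)⟩ ⟨hd, ((hab.trans_le hbd).ne' : d ≠ a)⟩ hbd

lemma Fintype.sum_apply_update {ι : Type*} [Fintype ι] [DecidableEq ι] (F : ι → ℝ → ℝ)
    (q : ι → ℝ) (c : ι) (v : ℝ) :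
    ∑ d, F d (Function.update q c v d) = ∑ d, F d (q d) + (F c v - F c (q c)) := by
  rw [← sub_eq_iff_eq_add', ← Finset.sum_sub_distrib, Finset.sum_eq_single c]
  · simp
  · intro d _ hd
    simp [hd]
  · simp

namespace NetworkGame

variable {N : Type*} [Fintype N] [DecidableEq N] {G : NetworkGame N} {U V : Finset N}

/-! ### Gains from single edges -/

/-- What agent `i` gains from the weight `t` on `C` when all other weights are `0`. -/
noncomputable def edgeGain (G : NetworkGame N) (i : N) (C : G.edges) (t : ℝ) : ℝ :=
  G.payoff i (Function.update 0 C t) - G.payoff i 0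

/-- The sum of the gains of agent `i` from the edges that contain `i`. -/
noncomputable def gain (G : NetworkGame N) (i : N) (x : G.Weights) : ℝ :=
  ∑ C : G.edges, if i ∈ C.1 then G.edgeGain i C (x C) else 0

lemma update_zero_mem_networks (C : G.edges) {t : ℝ} (ht : t ∈ Set.Icc (0 : ℝ) 1) :
    Function.update (0 : G.Weights) C t ∈ G.networks := by
  intro D
  rcases eq_or_ne D C with rfl | hD
  · simpa using ht
  · simp [hD]

lemma zero_mem_networks : (0 : G.Weights) ∈ G.networks := fun _ => ⟨le_rfl, zero_le_one⟩

lemma concaveOn_edgeGain (hconc : G.IsConcave) (i : N) (C : G.edges) :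
    ConcaveOn ℝ (Set.Icc (0 : ℝ) 1) (G.edgeGain i C) := by
  have h := (hconc i C 0 zero_mem_networks).add_const (-G.payoff i 0)
  have heq : G.edgeGain i C =
      (fun t => G.payoff i (Function.update 0 C t)) + fun _ => -G.payoff i 0 :=
    funext fun _ => sub_eq_add_neg _ _
  rw [heq]
  exact h

lemma continuousOn_edgeGain (hcont : G.IsContinuous) (i : N) (C : G.edges) :
    ContinuousOn (G.edgeGain i C) (Set.Icc (0 : ℝ) 1) := by
  refine ContinuousOn.sub ((hcont i).comp ?_ fun t ht => update_zero_mem_networks C ht)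
    continuousOn_const
  have h : Continuous fun t : ℝ => Function.update (0 : G.Weights) C t :=
    continuous_const.update C continuous_id
  exact h.continuousOn

lemma edgeGain_of_notMem (hne : G.NoExternalities) {i : N} {C : G.edges} (hC : i ∉ C.1) {t : ℝ}
    (ht : t ∈ Set.Icc (0 : ℝ) 1) : G.edgeGain i C t = 0 := by
  -- `isValid_gdaInit` serves only to show that the zero network is feasible.
  refine sub_eq_zero.mpr (hne i 0 (isValid_gdaInit (V := ∅)).feasible _
    (update_zero_mem_networks C ht) fun D hD => ?_).symm
  rw [Function.update_of_ne]
  rintro rfl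
  exact hC hD

/-- The summands in `IsSeparable` are determined only up to constants. Evaluating at networks with a
single nonzero weight identifies their increments from `0` with `edgeGain`. -/
lemma payoff_eq_add_gain (hsep : G.IsSeparable) (hne : G.NoExternalities) (i : N) {x : G.Weights}
    (hx : ∀ C, 0 ≤ x C ∧ x C ≤ G.cap C) : G.payoff i x = G.payoff i 0 + G.gain i x := by
  obtain ⟨w, hw⟩ := hsep
  have hw0 : G.payoff i 0 = ∑ C, w C 0 i := hw 0 (fun C => ⟨le_rfl, G.cap_nonneg C⟩) i
  have hgain (C : G.edges) : w C (x C) i - w C 0 i = G.edgeGain i C (x C) := by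
    rw [edgeGain, hw _ (fun D => ?_) i, Fintype.sum_apply_update (fun D t => w D t i), hw0]
    · simp
    · rcases eq_or_ne D C with rfl | hD
      · simpa using hx D
      · simpa [hD] using G.cap_nonneg D
  rw [hw x hx i, hw0, gain, ← sub_eq_iff_eq_add', ← Finset.sum_sub_distrib]
  refine Finset.sum_congr rfl fun C _ => ?_
  rw [hgain]
  split_ifs with hC
  · rfl
  · exact edgeGain_of_notMem hne hC ⟨(hx C).1, (hx C).2.trans (G.cap_le_one C)⟩

lemma ownPayoff_eq_add_gain (hsep : G.IsSeparable) (hne : G.NoExternalities) {i : N}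
    {x : G.Weights} (hx : ∀ C : G.edges, i ∈ C.1 → 0 ≤ x C ∧ x C ≤ G.cap C) :
    G.ownPayoff i x = G.payoff i 0 + G.gain i x := by
  rw [ownPayoff, payoff_eq_add_gain hsep hne i]
  · congr 1
    refine Finset.sum_congr rfl fun C _ => ?_
    split_ifs with hC <;> simp [hC]
  · intro C
    split_ifs with hC
    exacts [hx C hC, ⟨le_rfl, G.cap_nonneg C⟩]

lemma isMaxOn_gain (hsep : G.IsSeparable) (hne : G.NoExternalities) {i : N}
    {lo hi q : G.Weights} (hlo : ∀ C, 0 ≤ lo C) (hhi : ∀ C, hi C ≤ G.cap C)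
    (hq : q ∈ G.bestChoices i lo hi) : IsMaxOn (G.gain i) (G.choices i lo hi) q := by
  have key {y : G.Weights} (hy : y ∈ G.choices i lo hi) :
      G.ownPayoff i y = G.payoff i 0 + G.gain i y :=
    ownPayoff_eq_add_gain hsep hne fun C hC =>
      ⟨(hlo C).trans (hy.1 C hC).1, (hy.1 C hC).2.trans (hhi C)⟩
  intro y hy
  have h : G.ownPayoff i y ≤ G.ownPayoff i q := hq.2 hy
  rw [key hy, key hq.1] at h
  exact le_of_add_le_add_left h

lemma gain_update {i : N} (q : G.Weights) {C : G.edges} (hC : i ∈ C.1) (v : ℝ) :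
    G.gain i (Function.update q C v) =
      G.gain i q + (G.edgeGain i C v - G.edgeGain i C (q C)) := by
  have h := Fintype.sum_apply_update
    (fun (D : G.edges) t => if i ∈ D.1 then G.edgeGain i D t else 0) q C v
  simpa only [gain, hC, if_true] using h

lemma load_update {i : N} (q : G.Weights) {C : G.edges} (hC : i ∈ C.1) (v : ℝ) :
    G.load i (Function.update q C v) = G.load i q + (v - q C) := by
  have h := Fintype.sum_apply_update (fun (D : G.edges) t => if i ∈ D.1 then t else 0) q C v
  simpa only [load, hC, if_true] using h

/-! ### Marginal conditions -/

/-- Agent `i` does not gain by decreasing the weight `v` of `C`. -/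
def NoGainDown (G : NetworkGame N) (i : N) (C : G.edges) (v : ℝ) : Prop :=
  ∀ s, 0 ≤ s → s < v → 0 ≤ slope (G.edgeGain i C) s v

/-- Agent `i` does not gain by increasing the weight `v` of `C`. -/
def NoGainUp (G : NetworkGame N) (i : N) (C : G.edges) (v : ℝ) : Prop :=
  ∀ t, v < t → t ≤ G.cap C → slope (G.edgeGain i C) v t ≤ 0

/-- Agent `i` does not gain by increasing the weight `v` of `C` at the expense of the weight `w`
of `D`. -/
def NoGainSwap (G : NetworkGame N) (i : N) (C D : G.edges) (v w : ℝ) : Prop :=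
  ∀ t, v < t → t ≤ G.cap C → ∀ s, 0 ≤ s → s < w →
    slope (G.edgeGain i C) v t ≤ slope (G.edgeGain i D) s w

/-- Agent `i` has no use for more weight on `C`. -/
structure IsSaturated (G : NetworkGame N) (i : N) (C : G.edges) (x : G.Weights) : Prop where
  swap : ∀ D : G.edges, i ∈ D.1 → D ≠ C → G.NoGainSwap i C D (x C) (x D)
  up : G.load i x < G.budget i → G.NoGainUp i C (x C)

lemma NoGainDown.anti (hconc : G.IsConcave) {i : N} {C : G.edges} {v v' : ℝ}
    (h : G.NoGainDown i C v) (hv : v' ≤ v) (hv1 : v ≤ 1) : G.NoGainDown i C v' := by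
  intro s hs hsv
  refine (h s hs (hsv.trans_le hv)).trans ?_
  exact (concaveOn_edgeGain hconc i C).slope_le_slope ⟨hs, by linarith⟩ ⟨by linarith, by linarith⟩
    ⟨hs, by linarith⟩ ⟨by linarith, by linarith⟩ hsv (hsv.trans_le hv) le_rfl hv

/-- By concavity, more weight on `C` makes its further increase less attractive, and less weight on
`D` makes its further decrease more costly. -/
lemma NoGainSwap.mono (hconc : G.IsConcave) {i : N} {C D : G.edges} {v v' w w' : ℝ}
    (h : G.NoGainSwap i C D v w) (hv0 : 0 ≤ v) (hv : v ≤ v') (hw : w' ≤ w) (hw1 : w ≤ 1) :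
    G.NoGainSwap i C D v' w' := by
  intro t hvt ht s hs hsw
  have ht1 := ht.trans (G.cap_le_one C)
  calc slope (G.edgeGain i C) v' t ≤ slope (G.edgeGain i C) v t :=
        (concaveOn_edgeGain hconc i C).slope_le_slope ⟨hv0, by linarith⟩ ⟨by linarith, ht1⟩
          ⟨by linarith, by linarith⟩ ⟨by linarith, ht1⟩ (hv.trans_lt hvt) hvt hv le_rfl
    _ ≤ slope (G.edgeGain i D) s w := h t (hv.trans_lt hvt) ht s hs (hsw.trans_le hw)
    _ ≤ slope (G.edgeGain i D) s w' :=
        (concaveOn_edgeGain hconc i D).slope_le_slope ⟨hs, by linarith⟩ ⟨by linarith, by linarith⟩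
          ⟨hs, by linarith⟩ ⟨by linarith, by linarith⟩ hsw (hsw.trans_le hw) le_rfl hw

/-! ### First-order conditions at a constrained maximum -/

section Choice

variable {i : N} {lo hi q : G.Weights}

/-- Maximality only tests decreases down to `lo C`. If `q C` lies strictly above `lo C`, concavity
extends the conclusion further down; otherwise it is the hypothesis `h`. -/
lemma noGainDown_of_isMaxOn (hconc : G.IsConcave) (hlo : ∀ C, 0 ≤ lo C)
    (hhi : ∀ C, hi C ≤ G.cap C) (hq : q ∈ G.choices i lo hi)
    (hmax : IsMaxOn (G.gain i) (G.choices i lo hi) q) {C : G.edges} (hC : i ∈ C.1)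
    (h : G.NoGainDown i C (lo C)) : G.NoGainDown i C (q C) := by
  have hq1 : q C ≤ 1 := (hq.1 C hC).2.trans ((hhi C).trans (G.cap_le_one C))
  rcases (hq.1 C hC).1.eq_or_lt with heq | hlt
  · rwa [← heq]
  have above : ∀ s, lo C ≤ s → s < q C → 0 ≤ slope (G.edgeGain i C) s (q C) := by
    intro s hs hsq
    have hmem : Function.update q C s ∈ G.choices i lo hi := by
      refine ⟨fun D hD => ?_, ?_⟩
      · rcases eq_or_ne D C with rfl | hDC
        · simpa using ⟨hs, hsq.le.trans (hq.1 D hD).2⟩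
        · simpa [hDC] using hq.1 D hD
      · rw [load_update q hC]
        linarith [hq.2]
    have := hmax hmem
    rw [Set.mem_ofPred_eq, gain_update q hC] at this
    rw [slope_nonneg_iff_of_le hsq.le]
    linarith
  intro s hs hsq
  rcases le_or_gt (lo C) s with hle | hgt
  · exact above s hle hsq
  · refine (above (lo C) le_rfl hlt).trans ?_
    exact (concaveOn_edgeGain hconc i C).slope_le_slope ⟨hs, by linarith⟩ ⟨by linarith, hq1⟩
      ⟨hlo C, by linarith⟩ ⟨by linarith, hq1⟩ hsq hlt hgt.le le_rfl

lemma noGainUp_of_isMaxOn (hconc : G.IsConcave) (hlo : ∀ C, 0 ≤ lo C)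
    (hq : q ∈ G.choices i lo hi) (hmax : IsMaxOn (G.gain i) (G.choices i lo hi) q)
    (hload : G.load i q < G.budget i) {C : G.edges} (hC : i ∈ C.1) (hqC : q C < hi C) :
    G.NoGainUp i C (q C) := by
  intro t hqt ht
  have ht1 := ht.trans (G.cap_le_one C)
  have hq0 : 0 ≤ q C := (hlo C).trans (hq.1 C hC).1
  -- `t` may exceed `hi C` or the budget, so maximality is tested on a small increase `ε`; concavity
  -- passes from there to `t`.
  obtain ⟨ε, hε, hle⟩ : ∃ ε > 0, ε ≤ G.budget i - G.load i q ∧ ε ≤ hi C - q C ∧ ε ≤ t - q C :=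
    ⟨min (G.budget i - G.load i q) (min (hi C - q C) (t - q C)),
      lt_min (sub_pos.mpr hload) (lt_min (sub_pos.mpr hqC) (sub_pos.mpr hqt)),
      min_le_left _ _, (min_le_right _ _).trans (min_le_left _ _),
      (min_le_right _ _).trans (min_le_right _ _)⟩
  obtain ⟨hε1, hε2, hε3⟩ := hle
  have hmem : Function.update q C (q C + ε) ∈ G.choices i lo hi := by
    refine ⟨fun D hD => ?_, ?_⟩
    · rcases eq_or_ne D C with rfl | hDC
      · rw [Function.update_self]
        have := hq.1 D hD
        constructor <;> linarith
      · simpa [hDC] using hq.1 D hD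
    · rw [load_update q hC]
      linarith
  have hg := hmax hmem
  rw [Set.mem_ofPred_eq, gain_update q hC] at hg
  calc slope (G.edgeGain i C) (q C) t ≤ slope (G.edgeGain i C) (q C) (q C + ε) :=
        (concaveOn_edgeGain hconc i C).slope_le_slope ⟨hq0, by linarith⟩ ⟨by linarith, by linarith⟩
          ⟨hq0, by linarith⟩ ⟨by linarith, ht1⟩ (by linarith) hqt le_rfl (by linarith)
    _ ≤ 0 := by
        rw [slope_def_field]
        exact div_nonpos_of_nonpos_of_nonneg (by linarith) (by linarith)

/-- Shifting `ε` from `D` to `C` leaves the load unchanged, so maximality compares the two secants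
of length `ε`. Concavity extends this to `t` and `s`. -/
lemma noGainSwap_of_isMaxOn (hconc : G.IsConcave) (hlo : ∀ C, 0 ≤ lo C)
    (hhi : ∀ C, hi C ≤ G.cap C) (hq : q ∈ G.choices i lo hi)
    (hmax : IsMaxOn (G.gain i) (G.choices i lo hi) q) {C D : G.edges} (hC : i ∈ C.1)
    (hD : i ∈ D.1) (hDC : D ≠ C) (hqC : q C < hi C) (hqD : lo D < q D) :
    G.NoGainSwap i C D (q C) (q D) := by
  intro t hqt ht s hs hsq
  have ht1 := ht.trans (G.cap_le_one C)
  have hq0 : 0 ≤ q C := (hlo C).trans (hq.1 C hC).1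
  have hq1 : q D ≤ 1 := (hq.1 D hD).2.trans ((hhi D).trans (G.cap_le_one D))
  obtain ⟨ε, hε, hle⟩ : ∃ ε > 0, (ε ≤ hi C - q C ∧ ε ≤ q D - lo D) ∧ ε ≤ t - q C ∧ ε ≤ q D - s :=
    ⟨min (min (hi C - q C) (q D - lo D)) (min (t - q C) (q D - s)),
      lt_min (lt_min (sub_pos.mpr hqC) (sub_pos.mpr hqD))
        (lt_min (sub_pos.mpr hqt) (sub_pos.mpr hsq)),
      ⟨(min_le_left _ _).trans (min_le_left _ _), (min_le_left _ _).trans (min_le_right _ _)⟩,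
      (min_le_right _ _).trans (min_le_left _ _), (min_le_right _ _).trans (min_le_right _ _)⟩
  obtain ⟨⟨hε1, hε2⟩, hε3, hε4⟩ := hle
  have hmem : Function.update (Function.update q C (q C + ε)) D (q D - ε) ∈
      G.choices i lo hi := by
    refine ⟨fun E hE => ?_, ?_⟩
    · have := hq.1 E hE
      rcases eq_or_ne E D with rfl | hED
      · rw [Function.update_self]
        constructor <;> linarith
      · rw [Function.update_of_ne hED]
        rcases eq_or_ne E C with rfl | hEC
        · rw [Function.update_self]
          constructor <;> linarith
        · rwa [Function.update_of_ne hEC]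
    · rw [load_update _ hD, load_update q hC, Function.update_of_ne hDC]
      linarith [hq.2]
  have hg := hmax hmem
  rw [Set.mem_ofPred_eq, gain_update _ hD, gain_update q hC, Function.update_of_ne hDC] at hg
  calc slope (G.edgeGain i C) (q C) t ≤ slope (G.edgeGain i C) (q C) (q C + ε) :=
        (concaveOn_edgeGain hconc i C).slope_le_slope ⟨hq0, by linarith⟩ ⟨by linarith, by linarith⟩
          ⟨hq0, by linarith⟩ ⟨by linarith, ht1⟩ (by linarith) hqt le_rfl (by linarith)
    _ ≤ slope (G.edgeGain i D) (q D - ε) (q D) := by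
        rw [slope_def_field, slope_def_field, add_sub_cancel_left, sub_sub_cancel]
        exact div_le_div_of_nonneg_right (by linarith) hε.le
    _ ≤ slope (G.edgeGain i D) s (q D) :=
        (concaveOn_edgeGain hconc i D).slope_le_slope ⟨hs, by linarith⟩ ⟨by linarith, hq1⟩
          ⟨by linarith, by linarith⟩ ⟨by linarith, hq1⟩ hsq (by linarith) (by linarith) le_rfl

end Choice

/-! ### Limits -/

lemma tendsto_slope_left (hcont : G.IsContinuous) {i : N} {C : G.edges} {v : ℕ → ℝ} {a t : ℝ}
    (hv : Tendsto v atTop (𝓝 a)) (hv01 : ∀ n, v n ∈ Set.Icc (0 : ℝ) 1) (hat : a ≠ t) :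
    Tendsto (fun n => slope (G.edgeGain i C) (v n) t) atTop
      (𝓝 (slope (G.edgeGain i C) a t)) := by
  have ha : a ∈ Set.Icc (0 : ℝ) 1 := isClosed_Icc.mem_of_tendsto hv (Eventually.of_forall hv01)
  have hg : Tendsto (fun n => G.edgeGain i C (v n)) atTop (𝓝 (G.edgeGain i C a)) :=
    (continuousOn_edgeGain hcont i C a ha).tendsto.comp
      (tendsto_nhdsWithin_iff.mpr ⟨hv, Eventually.of_forall hv01⟩)
  simp only [slope_def_field]
  exact (hg.const_sub _).div (hv.const_sub _) (sub_ne_zero.mpr hat.symm)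

lemma noGainDown_of_tendsto (hcont : G.IsContinuous) {i : N} {C : G.edges} {v : ℕ → ℝ} {a : ℝ}
    (hv : Tendsto v atTop (𝓝 a)) (hv01 : ∀ n, v n ∈ Set.Icc (0 : ℝ) 1)
    (h : ∀ n, G.NoGainDown i C (v n)) : G.NoGainDown i C a := by
  intro s hs hsa
  -- `tendsto_slope_left` moves the first argument of `slope`.
  rw [slope_comm]
  refine ge_of_tendsto (tendsto_slope_left hcont hv hv01 hsa.ne') ?_
  filter_upwards [hv.eventually_const_lt hsa] with n hn
  rw [slope_comm]
  exact h n s hs hn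

/-- The premises `x C < t`, `s < x D` and slack in the budget are open conditions: if they hold at
the limit, they hold eventually, while the conclusions are closed. -/
lemma isSaturated_of_tendsto (hcont : G.IsContinuous) {i : N} {C : G.edges} {x : ℕ → G.Weights}
    {z : G.Weights} (hx : Tendsto x atTop (𝓝 z)) (hx01 : ∀ n, x n ∈ G.networks)
    (h : ∀ᶠ n in atTop, G.IsSaturated i C (x n)) : G.IsSaturated i C z := by
  have hxC := tendsto_pi_nhds.mp hx
  refine ⟨fun D hD hDC t ht htc s hs hsz => ?_, fun hload t ht htc => ?_⟩
  · rw [slope_comm (G.edgeGain i D)]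
    refine le_of_tendsto_of_tendsto (tendsto_slope_left hcont (hxC C) (fun n => hx01 n C) ht.ne)
      (tendsto_slope_left hcont (hxC D) (fun n => hx01 n D) hsz.ne') ?_
    filter_upwards [h, (hxC C).eventually_lt_const ht, (hxC D).eventually_const_lt hsz]
      with n hn hnt hns
    rw [slope_comm (G.edgeGain i D)]
    exact hn.swap D hD hDC t hnt htc s hs hns
  · refine le_of_tendsto (tendsto_slope_left hcont (hxC C) (fun n => hx01 n C) ht.ne) ?_
    filter_upwards [h, (hxC C).eventually_lt_const ht,
      (((continuous_load i).tendsto z).comp hx).eventually_lt_const hload] with n hn hnt hnl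
    exact hn.up hnl t hnt htc

/-! ### Deviations -/

lemma gain_le_of_le {i : N} {y z : G.Weights} (hy : ∀ C : G.edges, i ∈ C.1 → 0 ≤ y C ∧ y C ≤ z C)
    (hz : ∀ C : G.edges, i ∈ C.1 → G.NoGainDown i C (z C)) : G.gain i y ≤ G.gain i z := by
  refine Finset.sum_le_sum fun C _ => ?_
  split_ifs with hC
  · rcases (hy C hC).2.eq_or_lt with heq | hlt
    · rw [heq]
    · exact (slope_nonneg_iff_of_le hlt.le).mp (hz C hC _ (hy C hC).1 hlt)
  · exact le_rfl

/-- An agent without use for more weight on `C` does not gain by a feasible deviation that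
increases the weight of no other edge. -/
lemma IsSaturated.gain_le {i : N} {C : G.edges} {y z : G.Weights} (hsat : G.IsSaturated i C z)
    (hz : ∀ D : G.edges, i ∈ D.1 → G.NoGainDown i D (z D))
    (hy0 : ∀ D, 0 ≤ y D) (hyC : y C ≤ G.cap C)
    (hy : ∀ D : G.edges, i ∈ D.1 → D ≠ C → y D ≤ z D) (hload : G.load i y ≤ G.budget i) :
    G.gain i y ≤ G.gain i z := by
  rcases le_or_gt (y C) (z C) with hle | hlt
  · refine gain_le_of_le (fun D hD => ⟨hy0 D, ?_⟩) hz
    rcases eq_or_ne D C with rfl | hDC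
    exacts [hle, hy D hD hDC]
  -- `max σ 0` acts as a price of weight, a multiplier for the budget: on every edge of `i` the
  -- change in gain is at most the price times the change in weight.
  set σ := slope (G.edgeGain i C) (z C) (y C) with hσ
  have hterm (D : G.edges) (hD : i ∈ D.1) :
      G.edgeGain i D (y D) - G.edgeGain i D (z D) ≤ max σ 0 * (y D - z D) := by
    rcases eq_or_ne D C with rfl | hDC
    · have : G.edgeGain i D (y D) - G.edgeGain i D (z D) = σ * (y D - z D) := by
        rw [hσ, slope_def_field, div_mul_cancel₀ _ (sub_pos.mpr hlt).ne']
      rw [this]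
      exact mul_le_mul_of_nonneg_right (le_max_left _ _) (sub_pos.mpr hlt).le
    · rcases (hy D hD hDC).eq_or_lt with heq | hltD
      · simp [heq]
      · have h1 : max σ 0 ≤ slope (G.edgeGain i D) (y D) (z D) :=
          max_le (hsat.swap D hD hDC _ hlt hyC _ (hy0 D) hltD) (hz D hD _ (hy0 D) hltD)
        rw [slope_def_field, le_div_iff₀ (sub_pos.mpr hltD)] at h1
        linarith
  have hsum : G.gain i y - G.gain i z ≤ max σ 0 * (G.load i y - G.load i z) := by
    unfold gain load
    rw [← Finset.sum_sub_distrib, ← Finset.sum_sub_distrib, Finset.mul_sum]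
    refine Finset.sum_le_sum fun D _ => ?_
    split_ifs with hD
    · exact hterm D hD
    · simp
  -- Complementary slackness: with slack the price is `0`; without slack the load cannot increase.
  rcases lt_or_ge (G.load i z) (G.budget i) with hl | hl
  · rw [max_eq_right (hsat.up hl _ hlt hyC), zero_mul] at hsum
    linarith
  · have := mul_nonpos_of_nonneg_of_nonpos (le_max_right σ 0)
      (sub_nonpos.mpr (hload.trans hl))
    linarith

/-! ### Stability of the limit -/

namespace IsInfiniteRun

variable {s : ℕ → G.GDAState} {p : ℕ → G.Weights}

lemma isMaxOn_proposal (hbip : G.IsBipartition U V) (hsep : G.IsSeparable)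
    (hne : G.NoExternalities) (h : IsInfiniteRun U V s p) (n : ℕ) {i : N} (hi : i ∈ U) :
    IsMaxOn (G.gain i) (G.choices i (s n).weights (s n).cap) (p n) :=
  isMaxOn_gain hsep hne (fun C => ((h.isValid hbip n).feasible.1 C).1)
    (h.isValid hbip n).cap_le ((h.isRound n).1 i hi)

lemma proposal_le_cap (hbip : G.IsBipartition U V) (h : IsInfiniteRun U V s p) (n : ℕ)
    (C : G.edges) : p n C ≤ G.cap C :=
  ((h.isRound n).1.le_cap hbip C).trans ((h.isValid hbip n).cap_le C)

lemma isMaxOn_weights (hbip : G.IsBipartition U V) (hsep : G.IsSeparable)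
    (hne : G.NoExternalities) (h : IsInfiniteRun U V s p) (n : ℕ) {j : N} (hj : j ∈ V) :
    IsMaxOn (G.gain j) (G.choices j (fun _ => 0) (p n)) (s (n + 1)).weights :=
  isMaxOn_gain hsep hne (fun _ => le_rfl) (h.proposal_le_cap hbip n) ((h.isRound n).2.1 j hj)

lemma proposal_mem_networks (hbip : G.IsBipartition U V) (h : IsInfiniteRun U V s p) (n : ℕ) :
    p n ∈ G.networks := fun C =>
  ⟨((h.isValid hbip n).feasible.1 C).1.trans ((h.isRound n).1.weights_le hbip C),
    (h.proposal_le_cap hbip n C).trans (G.cap_le_one C)⟩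

lemma weights_mem_networks (hbip : G.IsBipartition U V) (h : IsInfiniteRun U V s p) (n : ℕ) :
    (s n).weights ∈ G.networks := fun C =>
  ⟨((h.isValid hbip n).feasible.1 C).1,
    ((h.isValid hbip n).feasible.1 C).2.trans (G.cap_le_one C)⟩

/-- The lower bound prevents a proposer from withdrawing accepted weight, so maximality alone is not
enough. The accepted weight is at most the previous proposal, whose condition it inherits by
`NoGainDown.anti`. -/
lemma noGainDown_proposal (hbip : G.IsBipartition U V) (hsep : G.IsSeparable)
    (hne : G.NoExternalities) (hconc : G.IsConcave) (h : IsInfiniteRun U V s p) {i : N}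
    (hi : i ∈ U) {C : G.edges} (hC : i ∈ C.1) (n : ℕ) : G.NoGainDown i C (p n C) := by
  have step (n : ℕ) (hn : G.NoGainDown i C ((s n).weights C)) : G.NoGainDown i C (p n C) :=
    noGainDown_of_isMaxOn hconc (fun C => (h.weights_mem_networks hbip n C).1)
      (h.isValid hbip n).cap_le ((h.isRound n).1 i hi).1 (h.isMaxOn_proposal hbip hsep hne n hi)
      hC hn
  induction n with
  | zero =>
    refine step 0 fun t ht0 ht => ?_
    rw [h.zero] at ht
    exact absurd ht ht0.not_gt
  | succ n ih =>
    exact step _ (ih.anti hconc ((h.isRound n).weights_le hbip C)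
      (h.proposal_mem_networks hbip n C).2)

lemma noGainDown_weights (hbip : G.IsBipartition U V) (hsep : G.IsSeparable)
    (hne : G.NoExternalities) (hconc : G.IsConcave) (h : IsInfiniteRun U V s p) {j : N}
    (hj : j ∈ V) {C : G.edges} (hC : j ∈ C.1) (n : ℕ) :
    G.NoGainDown j C ((s (n + 1)).weights C) :=
  noGainDown_of_isMaxOn hconc (fun _ => le_rfl) (h.proposal_le_cap hbip n)
    ((h.isRound n).2.1 j hj).1 (h.isMaxOn_weights hbip hsep hne n hj) hC
    fun _ ht0 ht => absurd ht ht0.not_gt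

lemma noGainDown_limit (hbip : G.IsBipartition U V) (hcont : G.IsContinuous)
    (hsep : G.IsSeparable) (hne : G.NoExternalities) (hconc : G.IsConcave)
    (h : IsInfiniteRun U V s p) {z : G.Weights}
    (hz : Tendsto (fun n => (s n).weights) atTop (𝓝 z)) (i : N) (C : G.edges) (hC : i ∈ C.1) :
    G.NoGainDown i C (z C) := by
  rcases hbip.mem_or_mem i with hi | hi
  · exact noGainDown_of_tendsto hcont (tendsto_pi_nhds.mp (h.tendsto_proposal hbip hz) C)
      (fun n => h.proposal_mem_networks hbip n C)
      (h.noGainDown_proposal hbip hsep hne hconc hi hC)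
  · exact noGainDown_of_tendsto hcont
      ((tendsto_add_atTop_iff_nat 1).mpr (tendsto_pi_nhds.mp hz C))
      (fun n => h.weights_mem_networks hbip (n + 1) C)
      (h.noGainDown_weights hbip hsep hne hconc hi hC)

/-- As long as the weight of `C` has not been reduced, the proposing side of `C` proposes as much
weight on `C` as it likes. -/
lemma isSaturated_proposal (hbip : G.IsBipartition U V) (hsep : G.IsSeparable)
    (hne : G.NoExternalities) (hconc : G.IsConcave) (h : IsInfiniteRun U V s p) {i : N}
    (hi : i ∈ U) {C : G.edges} (hC : i ∈ C.1) {n : ℕ} (hred : ¬ Reduced s p C n) :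
    G.IsSaturated i C (p n) := by
  have hlo (n : ℕ) (D : G.edges) : 0 ≤ (s n).weights D := (h.weights_mem_networks hbip n D).1
  have hq (n : ℕ) := ((h.isRound n).1 i hi).1
  refine ⟨fun D hD hDC => ?_, fun hload => ?_⟩
  · have step (n : ℕ) (hred : ¬ Reduced s p C n)
        (hn : G.NoGainSwap i C D ((s n).weights C) ((s n).weights D)) :
        G.NoGainSwap i C D (p n C) (p n D) := by
      -- At full original capacity there is no room to increase `C`, and the condition is vacuous.
      rcases ((hq n).1 C hC).2.eq_or_lt with heq | hlt
      · intro t ht htc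
        rw [heq, h.cap_eq_of_not_reduced hred] at ht
        exact absurd ht htc.not_gt
      -- If `D` sits at its lower bound, no weight can be moved away from it, and the condition
      -- comes from the current network; otherwise the swap was available and was rejected.
      rcases ((hq n).1 D hD).1.eq_or_lt with heqD | hltD
      · exact hn.mono hconc (hlo n C) ((hq n).1 C hC).1 heqD.ge (h.weights_mem_networks hbip n D).2
      · exact noGainSwap_of_isMaxOn hconc (hlo n) (h.isValid hbip n).cap_le (hq n)
          (h.isMaxOn_proposal hbip hsep hne n hi) hC hD hDC hlt hltD
    induction n with
    | zero =>
      refine step 0 hred fun t _ _ r hr0 hr => ?_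
      rw [h.zero] at hr
      exact absurd hr hr0.not_gt
    | succ n ih =>
      refine step _ hred ((ih fun hr => hred (hr.mono n.le_succ)).mono hconc
        (h.proposal_mem_networks hbip n C).1 ?_ ((h.isRound n).weights_le hbip D)
        (h.proposal_mem_networks hbip n D).2)
      exact (h.proposal_eq_of_not_reduced hbip hred).le
  · rcases ((hq n).1 C hC).2.eq_or_lt with heq | hlt
    · intro t ht htc
      rw [heq, h.cap_eq_of_not_reduced hred] at ht
      exact absurd ht htc.not_gt
    · exact noGainUp_of_isMaxOn hconc (hlo n) (hq n) (h.isMaxOn_proposal hbip hsep hne n hi)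
        hload hC hlt

/-- Once the weight of `C` has been reduced, the receiving side of `C` never wants more of it. -/
lemma isSaturated_weights (hbip : G.IsBipartition U V) (hsep : G.IsSeparable)
    (hne : G.NoExternalities) (hconc : G.IsConcave) (h : IsInfiniteRun U V s p) {j : N}
    (hj : j ∈ V) {C : G.edges} (hC : j ∈ C.1) {n : ℕ} (hred : Reduced s p C n) :
    G.IsSaturated j C (s n).weights := by
  induction n with
  | zero => obtain ⟨m, hm, -⟩ := hred; omega
  | succ n ih =>
    have hq := ((h.isRound n).2.1 j hj).1
    have hmax := h.isMaxOn_weights hbip hsep hne n hj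
    have hcap := h.proposal_le_cap hbip n
    have hxp := (h.isRound n).1.weights_le hbip
    have hswap {D E : G.edges} (hD : j ∈ D.1) (hE : j ∈ E.1) (hED : E ≠ D)
        (hlt : (s (n + 1)).weights D < p n D) :
        G.NoGainSwap j D E ((s (n + 1)).weights D) ((s (n + 1)).weights E) :=
      fun t ht htc r hr0 hr => noGainSwap_of_isMaxOn hconc (fun _ => le_rfl) hcap hq hmax hD hE
        hED hlt (hr0.trans_lt hr) t ht htc r hr0 hr
    have hup {D : G.edges} (hD : j ∈ D.1) (hlt : (s (n + 1)).weights D < p n D)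
        (hload : G.load j (s (n + 1)).weights < G.budget j) :
        G.NoGainUp j D ((s (n + 1)).weights D) :=
      noGainUp_of_isMaxOn hconc (fun _ => le_rfl) hq hmax hload hD hlt
    by_cases hlt : (s (n + 1)).weights C < p n C
    · exact ⟨fun D hD hDC => hswap hC hD hDC hlt, hup hC hlt⟩
    have hredn : Reduced s p C n := by
      obtain ⟨m, hm, hr⟩ := hred
      refine ⟨m, lt_of_le_of_ne (Nat.lt_succ_iff.mp hm) ?_, hr⟩
      rintro rfl
      exact hlt hr
    have hsat := ih hredn
    -- After an earlier cut and without a new one, the weight of `C` stays the same.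
    have hCeq : (s (n + 1)).weights C = (s n).weights C :=
      (le_antisymm ((h.isRound n).weights_le hbip C) (not_lt.mp hlt)).trans
        (h.proposal_eq_of_reduced hbip hredn)
    refine ⟨fun D hD hDC => ?_, fun hload => ?_⟩
    · rcases le_or_gt ((s (n + 1)).weights D) ((s n).weights D) with hle | hgt
      · exact (hsat.swap D hD hDC).mono hconc (h.weights_mem_networks hbip n C).1 hCeq.ge hle
          (h.weights_mem_networks hbip n D).2
      intro t ht htc r hr0 hr
      rw [hCeq] at ht ⊢
      -- `D` has grown. If the budget had slack before, the slope on `C` is at most `0`, hence at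
      -- most that on `D`. If not, some `E` has lost weight to make room, and its lost segment
      -- serves as a link: the slope on `C` is at most that on `E` by the old condition, and that on
      -- `E` is at most that on `D` because `E` has just been cut.
      rcases lt_or_ge (G.load j (s n).weights) (G.budget j) with hl | hl
      · exact (hsat.up hl t ht htc).trans (h.noGainDown_weights hbip hsep hne hconc hj hD n r hr0 hr)
      · obtain ⟨E, hE, hEx⟩ :
            ∃ E : G.edges, j ∈ E.1 ∧ (s (n + 1)).weights E < (s n).weights E := by
          by_contra! hall
          refine absurd (hq.2.trans hl) (not_le.mpr ?_)
          refine Finset.sum_lt_sum (fun E _ => ?_) ⟨D, Finset.mem_univ D, by simpa [hD] using hgt⟩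
          split_ifs with hE
          exacts [hall E hE, le_rfl]
        have hEC : E ≠ C := by
          rintro rfl
          exact hEx.ne hCeq
        have hDE : D ≠ E := by
          rintro rfl
          exact hEx.not_gt hgt
        exact (hsat.swap E hE hEC t ht htc _ (h.weights_mem_networks hbip (n + 1) E).1 hEx).trans
          (hswap hE hD hDE (hEx.trans_le (hxp E)) _ hEx ((h.isValid hbip n).feasible.1 E).2 r hr0 hr)
    · rw [hCeq]
      -- If slack has only just appeared, some `E` was cut although budget remained, so the slope on
      -- its lost segment is at most `0`; the old swap condition transfers this bound to `C`.
      rcases lt_or_ge (G.load j (s n).weights) (G.budget j) with hl | hl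
      · exact hsat.up hl
      · obtain ⟨E, hE, hEx⟩ :
            ∃ E : G.edges, j ∈ E.1 ∧ (s (n + 1)).weights E < (s n).weights E := by
          by_contra! hall
          exact absurd (hload.trans_le (hl.trans (load_mono hall))) (lt_irrefl _)
        have hEC : E ≠ C := by
          rintro rfl
          exact hEx.ne hCeq
        intro t ht htc
        exact (hsat.swap E hE hEC t ht htc _ (h.weights_mem_networks hbip (n + 1) E).1 hEx).trans
          (hup hE (hEx.trans_le (hxp E)) hload _ hEx ((h.isValid hbip n).feasible.1 E).2)

/-- At the limit, one of the two agents of each edge has no use for more weight on it. -/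
lemma exists_isSaturated_limit (hbip : G.IsBipartition U V) (hcont : G.IsContinuous)
    (hsep : G.IsSeparable) (hne : G.NoExternalities) (hconc : G.IsConcave)
    (h : IsInfiniteRun U V s p) {z : G.Weights}
    (hz : Tendsto (fun n => (s n).weights) atTop (𝓝 z)) (C : G.edges) :
    ∃ k ∈ C.1, G.IsSaturated k C z := by
  by_cases hr : ∃ m, Reduced s p C m
  · obtain ⟨m, hm⟩ := hr
    obtain ⟨j, hj, hjC, -⟩ := hbip.symm.exists_left C
    refine ⟨j, hjC, isSaturated_of_tendsto hcont hz (h.weights_mem_networks hbip) ?_⟩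
    filter_upwards [eventually_ge_atTop m] with n hn
    exact h.isSaturated_weights hbip hsep hne hconc hj hjC (hm.mono hn)
  · push Not at hr
    obtain ⟨i, hi, hiC, -⟩ := hbip.exists_left C
    exact ⟨i, hiC, isSaturated_of_tendsto hcont (h.tendsto_proposal hbip hz)
      (h.proposal_mem_networks hbip)
      (Eventually.of_forall fun n => h.isSaturated_proposal hbip hsep hne hconc hi hiC (hr n))⟩

lemma isFullyStable_limit (hbip : G.IsBipartition U V) (hcont : G.IsContinuous)
    (hsep : G.IsSeparable) (hne : G.NoExternalities) (hconc : G.IsConcave)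
    (h : IsInfiniteRun U V s p) {z : G.Weights}
    (hz : Tendsto (fun n => (s n).weights) atTop (𝓝 z)) : G.IsFullyStable z := by
  have hfeas := h.limit_mem_feasible hbip hz
  have hdown := h.noGainDown_limit hbip hcont hsep hne hconc hz
  refine ⟨hfeas, fun i y hy hoff hon => ?_, fun C y hy hoff _ hyC hadj hgt => ?_⟩
  · have hyz (C : G.edges) : y C ≤ z C := by
      by_cases hC : i ∈ C.1
      exacts [hon C hC, (hoff C hC).le]
    rw [payoff_eq_add_gain hsep hne i hfeas.1, payoff_eq_add_gain hsep hne i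
      fun C => ⟨(hy C).1, (hyz C).trans (hfeas.1 C).2⟩]
    exact add_le_add_right (gain_le_of_le (fun C _ => ⟨(hy C).1, hyz C⟩) (hdown i)) _
  · by_contra! hload
    -- If the deviation respected the budgets of both endpoints, the saturated endpoint would have
    -- to gain strictly, against `IsSaturated.gain_le`.
    obtain ⟨k, hk, hsat⟩ := h.exists_isSaturated_limit hbip hcont hsep hne hconc hz C
    have hyz (D : G.edges) (hD : D ≠ C) : y D ≤ z D := by
      by_cases hCD : Disjoint C.1 D.1
      exacts [(hoff D hCD).le, hadj D hD hCD]
    have hybox (D : G.edges) : 0 ≤ y D ∧ y D ≤ G.cap D := by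
      refine ⟨(hy D).1, ?_⟩
      rcases eq_or_ne D C with rfl | hD
      exacts [hyC, (hyz D hD).trans (hfeas.1 D).2]
    have hlt := hgt k hk
    rw [payoff_eq_add_gain hsep hne k hfeas.1, payoff_eq_add_gain hsep hne k hybox] at hlt
    have hle := hsat.gain_le (hdown k) (fun D => (hy D).1) hyC (fun D _ => hyz D) (hload k hk)
    linarith

end IsInfiniteRun

end NetworkGame

theorem mainTheorem2 {N : Type*} [Fintype N] [DecidableEq N] (G : NetworkGame N)
    (U V : Finset N) (hbip : G.IsBipartition U V) (hcont : G.IsContinuous)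
    (hne : G.NoExternalities) :
    -- every instruction of the algorithm can be executed, however ties have been broken so far
    (∀ s, G.GDAReachable U V s →
      (∃ p, G.IsProposal U s p) ∧ ∀ p, G.IsProposal U s p → ∃ t, G.IsRound U V s p t) ∧
    (∃ r : G.GDARun U V, r.IsPrompt) ∧
    -- every run converges to a feasible network
    (∀ r : G.GDARun U V, ∃ z ∈ G.feasible, r.ConvergesTo z) ∧
    -- under separability and concavity the limit is fully stable
    (G.IsSeparable → G.IsConcave →
      ∀ (r : G.GDARun U V) (z : G.Weights), r.ConvergesTo z → G.IsFullyStable z) := by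
  refine ⟨fun s hs => ?_, NetworkGame.exists_isPrompt hbip hcont, fun r => ?_, fun hsep hconc r z hz => ?_⟩
  · have hv := hs.isValid hbip
    exact ⟨hv.exists_isProposal hbip hcont, fun p hp => hv.exists_isRound hbip hcont hp⟩
  · obtain ⟨s, p, h, hiff⟩ := r.exists_isInfiniteRun hbip
    obtain ⟨z, hz⟩ := h.exists_tendsto hbip
    exact ⟨z, h.limit_mem_feasible hbip hz, (hiff z).mpr hz⟩
  · obtain ⟨s, p, h, hiff⟩ := r.exists_isInfiniteRun hbip
    exact h.isFullyStable_limit hbip hcont hsep hne hconc ((hiff z).mp hz)
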